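/- Let $k$ be a field and let $A$, $B$ be preadic noetherian $k$-algebras, that is, noetherian commutative $k$-algebras which are topological rings whose topologies are the $\mathfrak a$-adic and the $\mathfrak b$-adic topology for ideals (of definition) $\mathfrak a\subseteq A$ and $\mathfrak b\subseteq B$ (not necessarily separated or complete). Assume $\mathfrak b\neq B$. Let $\widehat A=\varprojlim_n A/\mathfrak a^n$ be the completion of $A$, and let $E=A\,\widehat\otimes_k B$ be the completion of $A\otimes_k B$ for the tensor product topology, i.e. the $\mathfrak r$-adic topology with $\mathfrak r=\mathfrak a(A\otimes_k B)+\mathfrak b(A\otimes_k B)$. Let $\mathbf R$ be a property of noetherian local rings which descends by faithful flatness: if $S\to T$ is a faithfully flat homomorphism of noetherian local rings and $T$ has $\mathbf R$, then $S$ has $\mathbf R$. A ring $S$ is said to satisfy $\mathbf R$ (locally) if it is noetherian and $S_{\mathfrak p}$ has $\mathbf R$ for every prime ideal $\mathfrak p$ of $S$. Consider the following conditions: (i) $E$ satisfies $\mathbf R$. (ii) $\widehat A$ satisfies $\mathbf R$. (iii) For every open maximal ideal $\mathfrak m$ of $A$, the local ring $A_{\mathfrak m}$ has $\mathbf R$,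 and all its localizations at prime ideals have $\mathbf R$ as well. If $E$ is noetherian, then (i) $\Rightarrow$ (ii) $\Rightarrow$ (iii). -/

import Mathlib

open scoped TensorProduct

universe u

/-- A property of noetherian local rings. -/
abbrev NoethLocalProperty : Type (u + 1) :=
  (S : Type u) → [CommRing S] → [IsLocalRing S] → [IsNoetherianRing S] → Prop

/-- The property `R` descends by faithful flatness: if `S → T` is a faithfully flat homomorphism of
noetherian local rings (equivalently, a flat local homomorphism) and `T` has `R`, then `S` has `R`.
As isomorphisms are faithfully flat, such a property is invariant under isomorphism. -/
def DescendsByFaithfulFlatness (R : NoethLocalProperty.{u}) : Prop :=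
  ∀ (S T : Type u) [CommRing S] [CommRing T] [IsLocalRing S] [IsLocalRing T]
    [IsNoetherianRing S] [IsNoetherianRing T] [Algebra S T] [Module.FaithfullyFlat S T],
    R T → R S

/-- A ring `S` satisfies the property `R` of noetherian local rings if `S` is noetherian and all its
localizations at prime ideals have `R`. -/
def SatisfiesLocally (R : NoethLocalProperty.{u}) (S : Type u) [CommRing S] : Prop :=
  ∃ _ : IsNoetherianRing S, ∀ (p : Ideal S) [p.IsPrime], R (Localization.AtPrime p)

section TensorTopology

variable (k : Type*) {A B : Type*} [Field k] [CommRing A] [CommRing B] [Algebra k A] [Algebra k B]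

/-- The ideal `𝔞 (A ⊗ B) + 𝔟 (A ⊗ B)` of `A ⊗[k] B`. For ideals of definition `𝔞` and `𝔟` of the
preadic algebras `A` and `B`, it is an ideal of definition of the tensor product topology. -/
def tensorIdeal (a : Ideal A) (b : Ideal B) : Ideal (A ⊗[k] B) :=
  a.map (Algebra.TensorProduct.includeLeft : A →ₐ[k] A ⊗[k] B) ⊔
    b.map (Algebra.TensorProduct.includeRight : B →ₐ[k] A ⊗[k] B)

/-- The ideals `𝔞 ^ i (A ⊗ B) + 𝔟 ^ j (A ⊗ B)`, which define the tensor product topology, contain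
powers of `tensorIdeal k a b`, and conversely by `tensorIdeal_pow_sup_le`: the tensor product
topology is the `tensorIdeal k a b`-preadic one. -/
theorem tensorIdeal_pow_le (a : Ideal A) (b : Ideal B) (i j : ℕ) :
    tensorIdeal k a b ^ (i + j) ≤ tensorIdeal k (a ^ i) (b ^ j) := by
  unfold tensorIdeal
  rw [Ideal.map_pow, Ideal.map_pow]
  exact Ideal.sup_pow_add_le_pow_sup_pow

theorem tensorIdeal_pow_sup_le (a : Ideal A) (b : Ideal B) (n : ℕ) :
    tensorIdeal k (a ^ n) (b ^ n) ≤ tensorIdeal k a b ^ n := by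
  unfold tensorIdeal
  rw [Ideal.map_pow, Ideal.map_pow]
  exact sup_le (Ideal.pow_right_mono le_sup_left n) (Ideal.pow_right_mono le_sup_right n)

/-- The completed tensor product of the `𝔞`-preadic algebra `A` and the `𝔟`-preadic algebra `B`: the
(separated) completion of `A ⊗[k] B` for the tensor product topology, as the limit of the quotients
by the powers of an ideal of definition. -/
abbrev CompletedTensorProduct (a : Ideal A) (b : Ideal B) : Type _ :=
  AdicCompletion (tensorIdeal k a b) (A ⊗[k] B)

end TensorTopology

/-! Both implications are descent along a flat map: if `S → T` is flat and a prime `p` of `S` lies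
under a prime `q` of `T`, then `S_p → T_q` is flat and local, hence faithfully flat, and `R` passes
from `T_q` to `S_p`.

For (ii) ⇒ (iii), an open maximal ideal `m` contains `a`, so `mÂ` is maximal over `m`, and `A_m →
Â_{mÂ}` is faithfully flat because `Â` is flat over the noetherian ring `A`.

For (i) ⇒ (ii), the map is `Â → E`. A `k`-linear form on `B` that kills `b` and sends `1` to `1`
induces an `Â`-linear retraction `E → Â`. Hence every ideal of `Â` is contracted from its extension:
`Â` inherits noetherianity from `E`, and each prime of `Â` lies under a prime of `E`. Flatness holds
because, `k` being a field, `(A/aⁿ) ⊗ (B/bⁿ)` is free over `A/aⁿ`. Relations over `E` are thus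
approximated by relations over `Â`; Artin–Rees in `Â` and Krull's theorem in `E` make the
approximation exact (`Module.Flat.of_free_approximations`). -/

/-! ### Descent along flat maps and localization -/

theorem SatisfiesLocally.of_flat {R : NoethLocalProperty.{u}}
    (hR : DescendsByFaithfulFlatness R) {S T : Type u} [CommRing S] [CommRing T]
    [IsNoetherianRing S] [Algebra S T] [Module.Flat S T]
    (hsurj : ∀ p : Ideal S, p.IsPrime → ∃ q : Ideal T, q.IsPrime ∧ q.comap (algebraMap S T) = p)
    (hT : SatisfiesLocally R T) : SatisfiesLocally R S := by
  obtain ⟨_, hT⟩ := hT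
  refine ⟨‹_›, fun p hp => ?_⟩
  obtain ⟨q, hq, rfl⟩ := hsurj p hp
  have : q.LiesOver (q.comap (algebraMap S T)) := ⟨rfl⟩
  let := Localization.AtPrime.algebraOfLiesOver (q.comap (algebraMap S T)) q
  have : Module.FaithfullyFlat (Localization.AtPrime (q.comap (algebraMap S T)))
    (Localization.AtPrime q) := Module.FaithfullyFlat.of_flat_of_isLocalHom
  exact hR _ _ (hT q)

/-- A local ring of a localization of `T` is isomorphic to a local ring of `T`. Invariance of `R`
under isomorphism comes from descent, an isomorphism being faithfully flat. -/
theorem SatisfiesLocally.localization {R : NoethLocalProperty.{u}}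
    (hR : DescendsByFaithfulFlatness R) {T : Type u} [CommRing T] (M : Submonoid T)
    (hT : SatisfiesLocally R T) : SatisfiesLocally R (Localization M) := by
  obtain ⟨_, hT⟩ := hT
  have hN : IsNoetherianRing (Localization M) := IsLocalization.isNoetherianRing M _ ‹_›
  refine ⟨hN, fun q hq => ?_⟩
  have e := IsLocalization.localizationLocalizationAtPrimeIsoLocalization M q
  let : Algebra (Localization.AtPrime q)
    (Localization.AtPrime (q.comap (algebraMap T (Localization M)))) :=
    e.symm.toRingEquiv.toRingHom.toAlgebra
  have : Module.Flat (Localization.AtPrime q)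
    (Localization.AtPrime (q.comap (algebraMap T (Localization M)))) :=
    RingHom.Flat.of_bijective e.symm.bijective
  have : IsLocalHom (algebraMap (Localization.AtPrime q)
    (Localization.AtPrime (q.comap (algebraMap T (Localization M))))) :=
    ⟨fun x hx => (MulEquiv.isUnit_map e.symm).mp hx⟩
  have : Module.FaithfullyFlat (Localization.AtPrime q)
    (Localization.AtPrime (q.comap (algebraMap T (Localization M)))) :=
    Module.FaithfullyFlat.of_flat_of_isLocalHom
  exact hR _ _ (hT (q.comap (algebraMap T (Localization M))))

theorem SatisfiesLocally.localizationAtPrime_of_adicCompletion {R : NoethLocalProperty.{u}}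
    (hR : DescendsByFaithfulFlatness R) {A : Type u} [CommRing A] [IsNoetherianRing A]
    (a m : Ideal A) [m.IsMaximal] (ham : a ≤ m) (h : SatisfiesLocally R (AdicCompletion a A)) :
    R (Localization.AtPrime m) ∧ SatisfiesLocally R (Localization.AtPrime m) := by
  let P := m.map (algebraMap A (AdicCompletion a A))
  have hP : P.IsMaximal := AdicCompletion.isMaximal_map_of_le a m ham (IsNoetherian.noetherian a)
  -- The contraction of `P` is proper and contains the maximal ideal `m`.
  have : P.LiesOver m :=
    ⟨Ideal.IsMaximal.eq_of_le ‹_› (Ideal.IsPrime.under A P).ne_top Ideal.le_comap_map⟩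
  let := Localization.AtPrime.algebraOfLiesOver m P
  have : Module.FaithfullyFlat (Localization.AtPrime m) (Localization.AtPrime P) :=
    Module.FaithfullyFlat.of_flat_of_isLocalHom
  refine ⟨?_, ?_⟩
  · obtain ⟨_, h⟩ := h
    exact hR _ _ (h P)
  · refine SatisfiesLocally.of_flat hR (fun p hp => ?_) (h.localization hR P.primeCompl)
    obtain ⟨q, hq⟩ := PrimeSpectrum.comap_surjective_of_faithfullyFlat
      (A := Localization.AtPrime m) (B := Localization.AtPrime P) ⟨p, hp⟩
    exact ⟨q.asIdeal, q.isPrime, congrArg PrimeSpectrum.asIdeal hq⟩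

/-! ### A flatness criterion -/

/-- In a finite module over a noetherian ring, submodules are closed for the topology defined by an
ideal contained in the Jacobson radical. -/
theorem Submodule.mem_of_forall_mem_sup_pow_smul {E M : Type*} [CommRing E] [IsNoetherianRing E]
    [AddCommGroup M] [Module E M] [Module.Finite E M] {J : Ideal E} (hJ : J ≤ Ideal.jacobson ⊥)
    (N : Submodule E M) {x : M} (hx : ∀ n : ℕ, x ∈ N ⊔ J ^ n • (⊤ : Submodule E M)) : x ∈ N := by
  have := Ideal.iInf_pow_smul_eq_bot_of_le_jacobson (M := M ⧸ N) J hJ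
  rw [← Submodule.Quotient.mk_eq_zero, ← Submodule.mem_bot E, ← this, Submodule.mem_iInf]
  intro n
  obtain ⟨y, hy, z, hz, rfl⟩ := Submodule.mem_sup.mp (hx n)
  rw [Submodule.Quotient.mk_add, (Submodule.Quotient.mk_eq_zero N).mpr hy, zero_add]
  have := Submodule.mem_map_of_mem (f := N.mkQ) hz
  rw [Submodule.map_smul''] at this
  exact Submodule.smul_mono le_rfl le_top this

/-- A form of the Artin-Rees lemma: approximate solutions of a homogeneous linear equation are
close to exact solutions. -/
theorem Ideal.exists_linearMap_mem_pow_imp {S M N : Type*} [CommRing S] [IsNoetherianRing S]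
    [AddCommGroup M] [Module S M] [AddCommGroup N] [Module S N] [Module.Finite S N]
    (I : Ideal S) (f : M →ₗ[S] N) :
    ∃ c : ℕ, ∀ (n : ℕ) (y : M), f y ∈ I ^ (n + c) • (⊤ : Submodule S N) →
      y ∈ LinearMap.ker f ⊔ I ^ n • (⊤ : Submodule S M) := by
  obtain ⟨c, hc⟩ := I.exists_pow_inf_eq_pow_smul (LinearMap.range f)
  refine ⟨c, fun n y hy => ?_⟩
  have h : f y ∈ I ^ (n + c) • (⊤ : Submodule S N) ⊓ LinearMap.range f := ⟨hy, y, rfl⟩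
  rw [hc _ (Nat.le_add_left c n), Nat.add_sub_cancel] at h
  have h' := Submodule.smul_mono (le_refl (I ^ n)) inf_le_right h
  rw [LinearMap.range_eq_map, ← Submodule.map_smul''] at h'
  obtain ⟨z, hz, hzy⟩ := h'
  refine Submodule.mem_sup.mpr ⟨y - z, ?_, z, hz, sub_add_cancel y z⟩
  rw [LinearMap.mem_ker, map_sub, hzy, sub_self]

/-- A flatness criterion: `E` is flat over `S` if it is a noetherian ring, Zariskian for `J`, and has
arbitrarily small ideals `L` such that `E ⧸ L` is a free `S ⧸ I ^ n`-module. -/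
theorem Module.Flat.of_free_approximations {S E : Type*} [CommRing S] [CommRing E]
    [Algebra S E] [IsNoetherianRing S] [IsNoetherianRing E] (I : Ideal S) (J : Ideal E)
    (hIJ : I.map (algebraMap S E) ≤ J) (hJ : J ≤ Ideal.jacobson ⊥)
    (H : ∀ n : ℕ, ∃ (ι : Type*) (σ : ι → E) (L : Ideal E), L ≤ J ^ n ∧
      (∀ x : E, ∃ c : ι →₀ S, x - c.sum (fun j s => s • σ j) ∈ L) ∧
      ∀ c : ι →₀ S, c.sum (fun j s => s • σ j) ∈ L → ∀ j, c j ∈ I ^ n) :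
    Module.Flat S E := by
  classical
  -- Equational criterion: a solution `x` over `E` of `∑ fᵢ xᵢ = 0` must be an `E`-combination of
  -- solutions over `S`, that is, lie in `N`.
  refine Module.Flat.of_forall_isTrivialRelation fun {l f x} hfx => ?_
  let F : (Fin l → S) →ₗ[S] S := Fintype.linearCombination S f
  let φ : (Fin l → S) →ₗ[S] (Fin l → E) := (Algebra.linearMap S E).compLeft (Fin l)
  let N : Submodule E (Fin l → E) := Submodule.span E (φ '' LinearMap.ker F)
  have hφ : ∀ (n : ℕ) (y : Fin l → S), y ∈ I ^ n • (⊤ : Submodule S (Fin l → S)) →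
      φ y ∈ J ^ n • (⊤ : Submodule E (Fin l → E)) := by
    intro n y hy
    refine Submodule.smul_induction_on hy (fun r hr m _ => ?_) (fun u v hu hv => ?_)
    · have : φ (r • m) = algebraMap S E r • φ m := by ext i; simp [φ]
      rw [this]
      refine Submodule.smul_mem_smul ?_ Submodule.mem_top
      exact Ideal.pow_right_mono hIJ n (Ideal.map_pow (algebraMap S E) I n ▸
        Ideal.mem_map_of_mem _ hr)
    · rw [map_add]; exact add_mem hu hv
  have hpi : ∀ (n : ℕ) (y : Fin l → E), (∀ i, y i ∈ J ^ n) →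
      y ∈ J ^ n • (⊤ : Submodule E (Fin l → E)) := by
    intro n y hy
    rw [← Finset.univ_sum_single y]
    refine sum_mem fun i _ => ?_
    have : (Pi.single i (y i) : Fin l → E) = y i • Pi.single i 1 := by
      rw [← Pi.single_smul, smul_eq_mul, mul_one]
    rw [this]
    exact Submodule.smul_mem_smul (hy i) Submodule.mem_top
  obtain ⟨c₀, hc₀⟩ := I.exists_linearMap_mem_pow_imp F
  have hxN : x ∈ N := by
    refine Submodule.mem_of_forall_mem_sup_pow_smul hJ N fun n => ?_
    -- The extra `c₀` pays for the Artin–Rees loss: for each `j`, the coefficients of the `xᵢ` at `σ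
    -- j` solve the equation modulo `I ^ (n + c₀)`, hence agree modulo `I ^ n` with an exact
    -- solution.
    obtain ⟨ι, σ, L, hL, hsur, hinj⟩ := H (n + c₀)
    choose c hc using fun i => hsur (x i)
    let s : Finset ι := Finset.univ.biUnion fun i => (c i).support
    have hsum : ∀ i, (c i).sum (fun j s => s • σ j) = ∑ j ∈ s, c i j • σ j := fun i =>
      Finsupp.sum_of_support_subset _ (Finset.subset_biUnion_of_mem (fun i => (c i).support)
        (Finset.mem_univ i)) _ (fun _ _ => zero_smul _ _)
    have hker : ∀ j, (fun i => c i j) ∈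
        LinearMap.ker F ⊔ I ^ n • (⊤ : Submodule S (Fin l → S)) := by
      intro j
      refine hc₀ n _ ?_
      have h1 : (∑ i, f i • c i).sum (fun j s => s • σ j) ∈ L := by
        have h2 : (∑ i, f i • c i).sum (fun j s => s • σ j) =
            ∑ i, f i • (c i).sum (fun j s => s • σ j) := by
          change Finsupp.linearCombination S σ _ = ∑ i, f i • Finsupp.linearCombination S σ _
          simp
        -- As `∑ fᵢ xᵢ = 0`, only the approximation errors remain, and they lie in `L`.
        have h3 : ∑ i, f i • (c i).sum (fun j s => s • σ j) =
            - ∑ i, f i • (x i - (c i).sum (fun j s => s • σ j)) := by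
          simp only [smul_sub, Finset.sum_sub_distrib, hfx, zero_sub, neg_neg]
        rw [h2, h3]
        refine neg_mem (sum_mem fun i _ => ?_)
        rw [algebra_compatible_smul E]
        exact L.smul_mem _ (hc i)
      have h4 := hinj _ h1 j
      have : F (fun i => c i j) = (∑ i, f i • c i) j := by
        simp [F, Fintype.linearCombination_apply, Finsupp.finsetSum_apply, mul_comm]
      rw [this, smul_eq_mul, Ideal.mul_top]
      exact h4
    have hx : x = (∑ j ∈ s, σ j • φ (fun i => c i j)) +
        fun i => x i - (c i).sum (fun j s => s • σ j) := by
      ext i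
      rw [Pi.add_apply, hsum, Finset.sum_apply]
      simp [φ, Algebra.smul_def, mul_comm]
    rw [hx]
    refine add_mem (sum_mem fun j _ => Submodule.smul_mem _ _ ?_)
      (le_sup_right (a := N) (hpi n _ fun i => Ideal.pow_le_pow_right (Nat.le_add_right n c₀)
        (hL (hc i))))
    obtain ⟨u, hu, v, hv, huv⟩ := Submodule.mem_sup.mp (hker j)
    rw [← huv, map_add]
    exact Submodule.add_mem_sup (Submodule.subset_span ⟨u, hu, rfl⟩) (hφ n v hv)
  obtain ⟨k, e, g, hg⟩ := Submodule.mem_span_set'.mp hxN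
  choose y hy hyg using fun j => (g j).2
  refine ⟨k, fun i j => y j i, e, fun i => ?_, fun j => ?_⟩
  · rw [← hg]
    simp [← hyg, φ, Algebra.smul_def, mul_comm]
  · have := hy j
    simpa [F, Fintype.linearCombination_apply, mul_comm] using this

/-! ### Functoriality of adic completion -/

namespace AdicCompletion

variable {R S : Type*} [CommRing R] [CommRing S] {I : Ideal R} {J : Ideal S}

theorem ker_evalₐ_eq_map_pow (hI : I.FG) (n : ℕ) :
    RingHom.ker (evalₐ I n) = I.map (algebraMap R (AdicCompletion I R)) ^ n := by
  ext x
  have h : x ∈ RingHom.ker (evalₐ I n) ↔ x ∈ LinearMap.ker (eval I R n) := by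
    rw [RingHom.mem_ker, LinearMap.mem_ker, ← factor_evalₐ_eq_eval I x (by simp)]
    exact (map_eq_zero_iff _ (Ideal.quotientEquivAlgOfEq R (by simp)).injective).symm
  rw [h, ← pow_smul_top_eq_ker_eval hI, Ideal.smul_top_eq_map, ← Ideal.map_pow]
  rfl

theorem map_le_jacobson_bot (hI : I.FG) :
    I.map (algebraMap R (AdicCompletion I R)) ≤ Ideal.jacobson ⊥ :=
  have := isAdicComplete_self I hI
  IsAdicComplete.le_jacobson_bot _

theorem evalₐ_mk_of_le {m n : ℕ} (hmn : m ≤ n) (s : AdicCauchySequence I R) :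
    evalₐ I m (mk I R s) = Ideal.Quotient.mk (I ^ m) (s n) := by
  rw [evalₐ_mk]
  exact (Ideal.mk_eq_mk I hmn s).symm

theorem pow_le_comap_pow (f : R →+* S) (h : I.map f ≤ J) (n : ℕ) : I ^ n ≤ (J ^ n).comap f :=
  Ideal.map_le_iff_le_comap.mp (Ideal.map_pow f I n ▸ Ideal.pow_right_mono h n)

theorem factorPow_comp_quotientMap_evalₐ (f : R →+* S) (h : I.map f ≤ J) {m n : ℕ} (hmn : m ≤ n) :
    (Ideal.Quotient.factorPow J hmn).comp
      ((Ideal.quotientMap (J ^ n) f (pow_le_comap_pow f h n)).comp (evalₐ I n).toRingHom) =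
      (Ideal.quotientMap (J ^ m) f (pow_le_comap_pow f h m)).comp (evalₐ I m).toRingHom := by
  ext x
  obtain ⟨s, rfl⟩ := mk_surjective I R x
  simp only [RingHom.comp_apply, AlgHom.toRingHom_eq_coe, RingHom.coe_coe,
    evalₐ_mk_of_le hmn s, evalₐ_mk, Ideal.quotientMap_mk]
  rfl

/-- The map between adic completions which is induced by a continuous ring homomorphism. -/
noncomputable def mapRingHom (f : R →+* S) (h : I.map f ≤ J) :
    AdicCompletion I R →+* AdicCompletion J S :=
  liftRingHom J
    (fun n => (Ideal.quotientMap (J ^ n) f (pow_le_comap_pow f h n)).comp (evalₐ I n).toRingHom)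
    (factorPow_comp_quotientMap_evalₐ f h)

theorem evalₐ_mapRingHom (f : R →+* S) (h : I.map f ≤ J) (n : ℕ) (x : AdicCompletion I R) :
    evalₐ J n (mapRingHom f h x) =
      Ideal.quotientMap (J ^ n) f (pow_le_comap_pow f h n) (evalₐ I n x) :=
  evalₐ_liftRingHom J _ (factorPow_comp_quotientMap_evalₐ f h) n x

theorem evalₐ_mapRingHom_mk (f : R →+* S) (h : I.map f ≤ J) (n : ℕ) (s : AdicCauchySequence I R) :
    evalₐ J n (mapRingHom f h (mk I R s)) = Ideal.Quotient.mk (J ^ n) (f (s n)) := by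
  rw [evalₐ_mapRingHom, evalₐ_mk, Ideal.quotientMap_mk]

theorem mapRingHom_algebraMap (f : R →+* S) (h : I.map f ≤ J) (x : R) :
    mapRingHom f h (algebraMap R _ x) = algebraMap S _ (f x) := by
  refine ext_evalₐ fun n => ?_
  rw [evalₐ_mapRingHom, AlgHom.commutes, AlgHom.commutes]
  rfl

/-- A continuous linear retraction of a ring homomorphism extends to the adic completions. -/
theorem exists_retraction_mapRingHom (f : R →+* S) (h : I.map f ≤ J) (g : S →+ R)
    (hg : ∀ x y, g (f x * y) = x * g y) (hg1 : g 1 = 1) (hJ : ∀ n, ∀ x ∈ J ^ n, g x ∈ I ^ n) :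
    ∃ ρ : AdicCompletion J S →+ AdicCompletion I R,
      (∀ x y, ρ (mapRingHom f h x * y) = x * ρ y) ∧ ρ 1 = 1 := by
  -- Quantifying over all representatives `t` determines `y` at every level, so additivity and
  -- linearity can be checked on any convenient representatives.
  have H : ∀ x : AdicCompletion J S, ∃ y : AdicCompletion I R, ∀ (n : ℕ) (t : S),
      evalₐ J n x = Ideal.Quotient.mk _ t → evalₐ I n y = Ideal.Quotient.mk _ (g t) := by
    intro x
    obtain ⟨s, rfl⟩ := mk_surjective J S x
    refine ⟨mk I R (AdicCauchySequence.mk I R (fun n => g (s n)) fun n => ?_), fun n t ht => ?_⟩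
    · have : s n - s (n + 1) ∈ J ^ n := by
        rw [← Ideal.Quotient.mk_eq_mk_iff_sub_mem]
        exact (Ideal.mk_eq_mk J (Nat.le_succ n) s).symm
      rw [SModEq.sub_mem, ← map_sub, smul_eq_mul, Ideal.mul_top]
      exact hJ n _ this
    · rw [evalₐ_mk, Ideal.Quotient.mk_eq_mk_iff_sub_mem] at ht
      rw [evalₐ_mk, Ideal.Quotient.mk_eq_mk_iff_sub_mem]
      have := hJ n _ ht
      rwa [map_sub] at this
  choose ρ hρ using H
  refine ⟨⟨⟨ρ, ?_⟩, ?_⟩, ?_, ?_⟩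
  · refine ext_evalₐ fun n => ?_
    rw [hρ 0 n 0 (by simp)]
    simp
  · intro x y
    refine ext_evalₐ fun n => ?_
    obtain ⟨s, rfl⟩ := mk_surjective J S x
    obtain ⟨t, rfl⟩ := mk_surjective J S y
    rw [map_add, hρ _ n (s n) (evalₐ_mk ..), hρ _ n (t n) (evalₐ_mk ..),
      hρ _ n (s n + t n) (by simp [evalₐ_mk]), map_add, map_add]
  · intro x y
    refine ext_evalₐ fun n => ?_
    obtain ⟨s, rfl⟩ := mk_surjective I R x
    obtain ⟨t, rfl⟩ := mk_surjective J S y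
    change evalₐ I n (ρ _) = evalₐ I n (_ * ρ _)
    rw [map_mul, hρ _ n (t n) (evalₐ_mk ..),
      hρ _ n (f (s n) * t n) (by rw [map_mul, evalₐ_mapRingHom_mk, evalₐ_mk, map_mul]),
      evalₐ_mk, hg, map_mul]
  · refine ext_evalₐ fun n => ?_
    change evalₐ I n (ρ _) = _
    rw [hρ 1 n 1 (by simp), hg1, map_one, map_one]

end AdicCompletion

/-- A ring homomorphism with a linear retraction is pure. -/
theorem Ideal.comap_map_eq_of_retraction {S T : Type*} [CommRing S] [CommRing T] (f : S →+* T)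
    (ρ : T →+ S) (hρ : ∀ x y, ρ (f x * y) = x * ρ y) (hρ1 : ρ 1 = 1) (I : Ideal S) :
    (I.map f).comap f = I := by
  refine le_antisymm (fun x hx => ?_) Ideal.le_comap_map
  -- The factor `t` carries the induction through multiplication by elements of `T`, for which `ρ`
  -- is not linear.
  have H : ∀ y ∈ I.map f, ∀ t, ρ (t * y) ∈ I := by
    intro y hy
    refine Submodule.span_induction (p := fun y _ => ∀ t, ρ (t * y) ∈ I) ?_ ?_ ?_ ?_ hy
    · rintro _ ⟨z, hz, rfl⟩ t
      rw [mul_comm, hρ]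
      exact I.mul_mem_right _ hz
    · simp
    · intro y z _ _ hy hz t
      rw [mul_add, map_add]
      exact add_mem (hy t) (hz t)
    · intro s y _ hy t
      rw [smul_eq_mul, ← mul_assoc]
      exact hy _
  have := H _ hx 1
  rwa [one_mul, ← mul_one (f x), hρ, hρ1, mul_one] at this

/-! ### The completed tensor product is pure and flat over the completion -/

section

variable {k : Type*} {A B : Type*} [Field k] [CommRing A] [CommRing B] [Algebra k A] [Algebra k B]

theorem map_includeLeft_le_tensorIdeal (a : Ideal A) (b : Ideal B) :
    a.map (algebraMap A (A ⊗[k] B)) ≤ tensorIdeal k a b := le_sup_left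

theorem tensorIdeal_fg {a : Ideal A} {b : Ideal B} (ha : a.FG) (hb : b.FG) :
    (tensorIdeal k a b).FG := Submodule.FG.sup (Ideal.FG.map ha _) (Ideal.FG.map hb _)

variable (k) in
/-- The canonical homomorphism from the completion of `A` to the completed tensor product. -/
noncomputable def CompletedTensorProduct.includeLeft (a : Ideal A) (b : Ideal B) :
    AdicCompletion a A →+* CompletedTensorProduct k a b :=
  AdicCompletion.mapRingHom _ (map_includeLeft_le_tensorIdeal a b)

/-- Used for continuity of the retraction: it kills the part coming from `b` altogether, so no power
of `J` need be kept. -/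
theorem Ideal.sup_pow_le_pow_sup {R : Type*} [CommRing R] (I J : Ideal R) (n : ℕ) :
    (I ⊔ J) ^ n ≤ I ^ n ⊔ J := by
  induction n with
  | zero => simp
  | succ n ih =>
    rw [pow_succ, pow_succ]
    refine (Ideal.mul_mono ih le_rfl).trans ?_
    rw [Ideal.sup_mul, Ideal.mul_sup]
    refine sup_le (sup_le le_sup_left ?_) ?_
    · exact le_sup_of_le_right Ideal.mul_le_right
    · exact le_sup_of_le_right Ideal.mul_le_left

theorem ker_map_mk (a : Ideal A) (b : Ideal B) :
    RingHom.ker (Algebra.TensorProduct.map (Ideal.Quotient.mkₐ k a) (Ideal.Quotient.mkₐ k b)) =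
      tensorIdeal k a b := by
  rw [Algebra.TensorProduct.map_ker _ _ (Ideal.Quotient.mkₐ_surjective k a)
    (Ideal.Quotient.mkₐ_surjective k b)]
  have h1 : RingHom.ker (Ideal.Quotient.mkₐ k a) = a := Ideal.mk_ker
  have h2 : RingHom.ker (Ideal.Quotient.mkₐ k b) = b := Ideal.mk_ker
  rw [h1, h2, tensorIdeal]

/-- Since `1 ∉ b`, some linear form `lam` on `B` vanishes on `b` with `lam 1 = 1`. The `A`-linear
map `x ⊗ y ↦ lam y • x` is continuous and extends to the completions. -/
theorem CompletedTensorProduct.exists_retraction (a : Ideal A) (b : Ideal B) (hb : b ≠ ⊤) :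
    ∃ ρ : CompletedTensorProduct k a b →+ AdicCompletion a A,
      (∀ x y, ρ (includeLeft k a b x * y) = x * ρ y) ∧ ρ 1 = 1 := by
  have h1 : (1 : B) ∉ b.restrictScalars k := fun h => hb ((Ideal.eq_top_iff_one b).mpr h)
  obtain ⟨l, hl1, hlb⟩ := Submodule.exists_le_ker_of_notMem h1
  let lam : B →ₗ[k] k := (l 1)⁻¹ • l
  have hlam1 : lam 1 = 1 := inv_mul_cancel₀ hl1
  have hlamb : ∀ y ∈ b, lam y = 0 := fun y hy => by
    have : l y = 0 := hlb hy
    simp [lam, this]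
  let g : A ⊗[k] B →ₗ[A] A :=
    (TensorProduct.AlgebraTensorModule.rid k A A).toLinearMap ∘ₗ
      TensorProduct.AlgebraTensorModule.lTensor A A lam
  have hg : ∀ x y, g (x ⊗ₜ y) = lam y • x := fun x y => by simp [g]
  refine AdicCompletion.exists_retraction_mapRingHom _ _ g.toAddMonoidHom (fun x y => ?_) ?_ ?_
  · change g (algebraMap A _ x * y) = x * g y
    rw [← Algebra.smul_def, map_smul, smul_eq_mul]
  · change g (1 ⊗ₜ 1) = 1
    rw [hg, hlam1, one_smul]
  · intro n x hx
    change g x ∈ a ^ n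
    obtain ⟨y, hy, z, hz, rfl⟩ := Submodule.mem_sup.mp (Ideal.sup_pow_le_pow_sup _ _ n hx)
    rw [map_add]
    refine add_mem ?_ ?_
    · rw [← Ideal.map_pow] at hy
      replace hy : y ∈ (a ^ n • ⊤ : Submodule A (A ⊗[k] B)) := by
        rw [Ideal.smul_top_eq_map]; exact hy
      refine Submodule.smul_induction_on hy (fun r hr m _ => ?_) (fun u v hu hv => ?_)
      · rw [map_smul]
        exact Ideal.mul_mem_right _ _ hr
      · rw [map_add]
        exact add_mem hu hv
    · suffices ∀ t, g (t * z) = 0 by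
        rw [← one_mul z, this]
        exact zero_mem _
      refine Submodule.span_induction (p := fun z _ => ∀ t, g (t * z) = 0) ?_ ?_ ?_ ?_ hz
      · rintro _ ⟨y, hy, rfl⟩ t
        induction t with
        | zero => simp
        | tmul u v =>
          simp [Algebra.TensorProduct.tmul_mul_tmul, hg, hlamb _ (b.mul_mem_left v hy)]
        | add u v hu hv => rw [add_mul, map_add, hu, hv, add_zero]
      · simp
      · intro y z _ _ hy hz t
        rw [mul_add, map_add, hy, hz, add_zero]
      · intro s y _ hy t
        rw [smul_eq_mul, ← mul_assoc]
        exact hy _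

variable (k) in
/-- The reduction of the completed tensor product modulo `𝔞 ^ n` and `𝔟 ^ n`. -/
noncomputable def CompletedTensorProduct.reduction (a : Ideal A) (b : Ideal B) (n : ℕ) :
    CompletedTensorProduct k a b →+* (A ⧸ a ^ n) ⊗[k] (B ⧸ b ^ n) :=
  -- Level `n + n` suffices because a product of `2n` elements of `𝔞 ∪ 𝔟` has at least `n` factors
  -- in one of the two ideals.
  (Ideal.Quotient.lift (tensorIdeal k a b ^ (n + n))
    (Algebra.TensorProduct.map (Ideal.Quotient.mkₐ k (a ^ n))
      (Ideal.Quotient.mkₐ k (b ^ n))).toRingHom fun x hx => by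
        have := tensorIdeal_pow_le k a b n n hx
        rwa [← ker_map_mk] at this).comp
    (AdicCompletion.evalₐ (tensorIdeal k a b) (n + n)).toRingHom

open CompletedTensorProduct

theorem CompletedTensorProduct.reduction_mk (a : Ideal A) (b : Ideal B) (n : ℕ)
    (s : AdicCompletion.AdicCauchySequence (tensorIdeal k a b) (A ⊗[k] B)) :
    reduction k a b n (AdicCompletion.mk _ _ s) = Algebra.TensorProduct.map
      (Ideal.Quotient.mkₐ k (a ^ n)) (Ideal.Quotient.mkₐ k (b ^ n)) (s (n + n)) := by
  simp only [reduction, RingHom.comp_apply, AlgHom.toRingHom_eq_coe, RingHom.coe_coe,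
    AdicCompletion.evalₐ_mk, Ideal.Quotient.lift_mk]

theorem CompletedTensorProduct.reduction_algebraMap (a : Ideal A) (b : Ideal B) (n : ℕ)
    (t : A ⊗[k] B) :
    reduction k a b n (algebraMap _ _ t) = Algebra.TensorProduct.map
      (Ideal.Quotient.mkₐ k (a ^ n)) (Ideal.Quotient.mkₐ k (b ^ n)) t := by
  simp only [reduction, RingHom.comp_apply, AlgHom.toRingHom_eq_coe, RingHom.coe_coe,
    AlgHom.commutes]
  exact Ideal.Quotient.lift_mk _ _ _

theorem CompletedTensorProduct.reduction_includeLeft (a : Ideal A) (b : Ideal B) (n : ℕ)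
    (x : AdicCompletion a A) :
    reduction k a b n (includeLeft k a b x) = AdicCompletion.evalₐ a n x ⊗ₜ 1 := by
  obtain ⟨s, rfl⟩ := AdicCompletion.mk_surjective a A x
  rw [AdicCompletion.evalₐ_mk_of_le (Nat.le_add_left n n)]
  simp only [reduction, RingHom.comp_apply, AlgHom.toRingHom_eq_coe, RingHom.coe_coe,
    includeLeft, AdicCompletion.evalₐ_mapRingHom_mk, Ideal.Quotient.lift_mk]
  simp

theorem CompletedTensorProduct.ker_reduction_le {a : Ideal A} {b : Ideal B} (ha : a.FG) (hb : b.FG)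
    (n : ℕ) : RingHom.ker (reduction k a b n) ≤
      (tensorIdeal k a b).map (algebraMap _ (CompletedTensorProduct k a b)) ^ n := by
  intro x hx
  obtain ⟨s, rfl⟩ := AdicCompletion.mk_surjective _ _ x
  rw [RingHom.mem_ker, reduction_mk] at hx
  have h : s (n + n) ∈ tensorIdeal k (a ^ n) (b ^ n) := by rwa [← ker_map_mk]
  rw [← AdicCompletion.ker_evalₐ_eq_map_pow (tensorIdeal_fg ha hb), RingHom.mem_ker,
    AdicCompletion.evalₐ_mk_of_le (Nat.le_add_left n n), Ideal.Quotient.eq_zero_iff_mem]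
  exact tensorIdeal_pow_sup_le k a b n h

/-- The criterion applies with `L` the kernel of the reduction to `(A/aⁿ) ⊗ (B/bⁿ)`: a `k`-basis of
`B/bⁿ` is an `A/aⁿ`-basis of this ring, and `σ` lifts it to `E`. -/
theorem CompletedTensorProduct.flat_includeLeft {a : Ideal A} {b : Ideal B} (ha : a.FG)
    (hb : b.FG) [IsNoetherianRing (AdicCompletion a A)]
    [IsNoetherianRing (CompletedTensorProduct k a b)] : (includeLeft k a b).Flat := by
  let := (includeLeft k a b).toAlgebra
  refine Module.Flat.of_free_approximations (a.map (algebraMap A (AdicCompletion a A)))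
    ((tensorIdeal k a b).map (algebraMap _ (CompletedTensorProduct k a b))) ?_
    (AdicCompletion.map_le_jacobson_bot (tensorIdeal_fg ha hb)) fun n => ?_
  · rw [Ideal.map_map, Ideal.map_le_iff_le_comap]
    intro x hx
    rw [Ideal.mem_comap, RingHom.comp_apply, RingHom.algebraMap_toAlgebra, includeLeft,
      AdicCompletion.mapRingHom_algebraMap]
    exact Ideal.mem_map_of_mem _ (map_includeLeft_le_tensorIdeal a b (Ideal.mem_map_of_mem _ hx))
  let β := Module.Basis.ofVectorSpace k (B ⧸ b ^ n)
  let γ := Algebra.TensorProduct.basis (A ⧸ a ^ n) β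
  choose τ hτ using fun j => Ideal.Quotient.mk_surjective (I := b ^ n) (β j)
  let σ := fun j => algebraMap _ (CompletedTensorProduct k a b) ((1 : A) ⊗ₜ[k] τ j)
  have hred : ∀ c : _ →₀ AdicCompletion a A, reduction k a b n (c.sum fun j s => s • σ j) =
      Finsupp.linearCombination _ γ
        (c.mapRange (AdicCompletion.evalₐ a n) (map_zero _)) := by
    intro c
    rw [Finsupp.linearCombination_apply, Finsupp.sum_mapRange_index (fun j => zero_smul _ (γ j)),
      map_finsuppSum]
    refine Finsupp.sum_congr fun j _ => ?_
    rw [Algebra.smul_def, map_mul, RingHom.algebraMap_toAlgebra, reduction_includeLeft,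
      reduction_algebraMap, Algebra.TensorProduct.map_tmul, Algebra.TensorProduct.basis_apply,
      TensorProduct.smul_tmul', Algebra.TensorProduct.tmul_mul_tmul, map_one, one_mul, mul_one,
      smul_eq_mul, mul_one, ← hτ]
    rfl
  refine ⟨_, σ, RingHom.ker (reduction k a b n), ker_reduction_le ha hb n, fun x => ?_,
    fun c hc j => ?_⟩
  · obtain ⟨c, hc⟩ := Finsupp.mapRange_surjective (AdicCompletion.evalₐ a n) (map_zero _)
      (AdicCompletion.surjective_evalₐ a n) (γ.repr (reduction k a b n x))
    refine ⟨c, ?_⟩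
    rw [RingHom.mem_ker, map_sub, hred, hc, γ.linearCombination_repr, sub_self]
  · rw [RingHom.mem_ker, hred] at hc
    have := DFunLike.congr_fun (linearIndependent_iff.mp γ.linearIndependent _ hc) j
    rw [← AdicCompletion.ker_evalₐ_eq_map_pow ha]
    exact this

end

/-! ### The two implications -/

theorem SatisfiesLocally.of_completedTensorProduct {R : NoethLocalProperty.{u}}
    (hR : DescendsByFaithfulFlatness R) {k : Type*} {A B : Type u} [Field k] [CommRing A]
    [CommRing B] [Algebra k A] [Algebra k B] {a : Ideal A} {b : Ideal B} (ha : a.FG) (hb : b.FG)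
    (hb' : b ≠ ⊤) (h : SatisfiesLocally R (CompletedTensorProduct k a b)) :
    SatisfiesLocally R (AdicCompletion a A) := by
  obtain ⟨hE, -⟩ := id h
  obtain ⟨ρ, hρ, hρ1⟩ := CompletedTensorProduct.exists_retraction (k := k) a b hb'
  have hpure := Ideal.comap_map_eq_of_retraction _ ρ hρ hρ1
  have : IsNoetherianRing (AdicCompletion a A) := by
    rw [isNoetherianRing_iff, isNoetherian_iff'] at hE ⊢
    -- By purity, extension of ideals is an order embedding, so the ascending chain condition passes
    -- from `E` to `Â`.
    let F : Ideal (AdicCompletion a A) ↪o Ideal (CompletedTensorProduct k a b) :=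
      OrderEmbedding.ofMapLEIff (Ideal.map (CompletedTensorProduct.includeLeft k a b))
        fun I J => ⟨fun hIJ => hpure I ▸ hpure J ▸ Ideal.comap_mono hIJ, Ideal.map_mono⟩
    exact F.dual.wellFoundedLT
  let := (CompletedTensorProduct.includeLeft k a b).toAlgebra
  have : Module.Flat (AdicCompletion a A) (CompletedTensorProduct k a b) :=
    CompletedTensorProduct.flat_includeLeft ha hb
  exact SatisfiesLocally.of_flat hR
    -- A prime that is contracted from its extension is the contraction of a prime.
    (fun p hp => (Ideal.comap_map_eq_self_iff_of_isPrime p).mp (hpure p)) h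

theorem IsAdic.le_of_isOpen_of_isPrime {A : Type*} [CommRing A] [TopologicalSpace A] {a : Ideal A}
    (ha : IsAdic a) {p : Ideal A} (hp : p.IsPrime) (h : IsOpen (p : Set A)) : a ≤ p := by
  obtain ⟨n, hn⟩ : ∃ n : ℕ, ((a ^ n : Ideal A) : Set A) ⊆ p := by
    have : (p : Set A) ∈ nhds 0 := h.mem_nhds p.zero_mem
    rw [IsAdic] at ha
    subst ha
    obtain ⟨n, -, hn⟩ := a.hasBasis_nhds_zero_adic.mem_iff.mp this
    exact ⟨n, hn⟩
  exact hp.le_of_pow_le hn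

theorem corollary3p3 {k : Type*} [Field k]
    {A B : Type u} [CommRing A] [CommRing B] [Algebra k A] [Algebra k B]
    [IsNoetherianRing A] [IsNoetherianRing B]
    [TopologicalSpace A] [IsTopologicalRing A] [TopologicalSpace B] [IsTopologicalRing B]
    (a : Ideal A) (b : Ideal B) (ha : IsAdic a) (hb : IsAdic b) (hb_ne : b ≠ ⊤)
    (R : NoethLocalProperty.{u}) (hR : DescendsByFaithfulFlatness R)
    (hE : IsNoetherianRing (CompletedTensorProduct k a b)) :
    (SatisfiesLocally R (CompletedTensorProduct k a b) →
      SatisfiesLocally R (AdicCompletion a A)) ∧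
    (SatisfiesLocally R (AdicCompletion a A) →
      ∀ (m : Ideal A) [m.IsMaximal], IsOpen (m : Set A) →
        R (Localization.AtPrime m) ∧ SatisfiesLocally R (Localization.AtPrime m)) := by
  refine ⟨fun h => h.of_completedTensorProduct hR (IsNoetherian.noetherian a)
    (IsNoetherian.noetherian b) hb_ne, fun h m hm hopen => ?_⟩
  exact h.localizationAtPrime_of_adicCompletion hR a m (ha.le_of_isOpen_of_isPrime hm.isPrime hopen)
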